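/- Let $n\ge 0$ be an integer. For a permutation $\sigma\in S_n$ let $P_\sigma$ be its permutation matrix ($P_\sigma(i,j)=1$ if $\sigma(i)=j$, and $0$ otherwise) and let $P^{[2]}_\sigma\in\mathbb{R}^{n^2\times n^2}$ be the matrix with entries $P^{[2]}_\sigma(ij,kl)=P_\sigma(i,j)P_\sigma(k,l)$. Let $\mathrm{QAP}_n=\mathrm{conv}\{P^{[2]}_\sigma : \sigma\in S_n\}$. A QAP4 inequality is an inequality $$\sum_{r=1}^{m}Y_{i_rj_r,i_rj_r}-\sum_{1\le r<s\le m}Y_{i_rj_r,i_sj_s}\le 1$$ in $Y\in\mathbb{R}^{n^2\times n^2}$, where $m\ge 7$, the indices $i_1,\dots,i_m\in[n]$ are distinct and the indices $j_1,\dots,j_m\in[n]$ are distinct (so $n\ge 7$). A bounded relaxation of $\mathrm{QAP}_n$ is a polytope (a bounded solution set of finitely many linear inequalities) $R\subset\mathbb{R}^{n^2\times n^2}$ with $\mathrm{QAP}_n\subseteq R$. The extension complexity $\mathrm{xc}(R)$ is the least number of facets of a polytope $Q\subset\mathbb{R}^{n^2\times n^2}\times\mathbb{R}^r$, $r\ge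 0$, with $R=\{x : \exists y,\ (x,y)\in Q\}$. If $R=\{x : A_ix\le b_i,\ i\in[p]\}=\mathrm{conv}\{v_1,\dots,v_t\}$ (redundant inequalities and points allowed), the matrix with entries $b_i-A_iv_j$ is called a slack matrix of $R$. Finally, let $N^1_n$ be the $2^n\times 2^n$ matrix with entries $N^1_n(a,b)=(a^{\top}b-1)(a^{\top}b-2)$, $a,b\in\{0,1\}^n$. (1) There are a constant $c>0$ and an integer $n_0$ such that for every $n\ge n_0$ and every bounded relaxation $R$ of $\mathrm{QAP}_n$ for which all QAP4 inequalities are valid, $\mathrm{xc}(R)\ge 2^{cn}$. (2) If exactly $q$ of the pairs $(i_r,j_r)$ of a QAP4 inequality satisfy $P_\sigma(i_r,j_r)=1$, then the slack of the inequality at $P^{[2]}_\sigma$ (the right-hand side minus the left-hand side) is $\binom{q-1}{2}=\frac{(q-1)(q-2)}{2}$ (so it is $1$ for $q=0$). (3) For every $n$ and every bounded relaxation $R$ of $\mathrm{QAP}_n$ for which all QAP4 inequalities are valid, some slack matrix of $R$ has as a submatrix the matrix $\frac12 N^1_n$ restricted to the rows $a$ with at least seven ones and to the columns $b$ whose number of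 zeros is not exactly one; the rows of this submatrix come from QAP4 inequalities and its columns from vertices $P^{[2]}_\sigma$ of $\mathrm{QAP}_n$. -/

import Mathlib

open scoped ENNReal

noncomputable section

section Polytopes

variable {E : Type*} [NormedAddCommGroup E] [NormedSpace ℝ E]

/-- A polytope: a bounded solution set of finitely many linear inequalities. -/
def IsPolytope (P : Set E) : Prop :=
  Bornology.IsBounded P ∧
    ∃ (p : ℕ) (A : Fin p → Module.Dual ℝ E) (b : Fin p → ℝ), P = {x | ∀ i, A i x ≤ b i}

/-- The dimension of a nonempty set: the dimension of the direction of its affine hull. -/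
def affDim (P : Set E) : ℕ := Module.finrank ℝ (vectorSpan ℝ P)

/-- A facet of `P`: a nonempty (exposed) face of dimension `dim P - 1`. -/
def IsFacet (P F : Set E) : Prop :=
  IsExposed ℝ P F ∧ F.Nonempty ∧ affDim F + 1 = affDim P

/-- The size of a polytope: its number of facets. -/
def polytopeSize (P : Set E) : ℕ∞ := {F : Set E | IsFacet P F}.encard

/-- `Q` is an extended formulation of `P` with `r` additional variables: a polytope
whose projection is `P`. -/
def IsExtension {r : ℕ} (Q : Set (E × (Fin r → ℝ))) (P : Set E) : Prop :=
  IsPolytope Q ∧ P = {x | ∃ y, (x, y) ∈ Q}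

/-- The extension complexity: the least number of facets of an extended formulation. -/
def extensionComplexity (P : Set E) : ℕ∞ :=
  ⨅ (r : ℕ) (Q : Set (E × (Fin r → ℝ))) (_ : IsExtension Q P), polytopeSize Q

/-- A description of `P` both by finitely many linear inequalities and as the convex hull of
finitely many points; redundant inequalities and points are allowed. -/
structure PolytopeDescription (P : Set E) where
  p : ℕ
  q : ℕ
  A : Fin p → Module.Dual ℝ E
  b : Fin p → ℝ
  v : Fin q → E
  eq_inequalities : P = {x | ∀ i, A i x ≤ b i}
  eq_convexHull : P = convexHull ℝ (Set.range v)

/-- The slack matrix of `P` with respect to a description of it. -/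
def PolytopeDescription.slackMatrix {P : Set E} (D : PolytopeDescription P) :
    Matrix (Fin D.p) (Fin D.q) ℝ :=
  Matrix.of fun i j => D.b i - D.A i (D.v j)

end Polytopes

/-- The space of real `n² × n²` matrices, rows and columns indexed by pairs;
`Y (i, j) (k, l)` is the entry `Y_{ij,kl}`. -/
abbrev QAPSpace (n : ℕ) : Type := Fin n × Fin n → Fin n × Fin n → ℝ

/-- The matrix `y yᵀ`, where `y` is the vectorized permutation matrix of `σ`. -/
def qapVertex {n : ℕ} (σ : Equiv.Perm (Fin n)) : QAPSpace n :=
  fun s t => σ.permMatrix ℝ s.1 s.2 * σ.permMatrix ℝ t.1 t.2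

/-- The QAP-polytope. -/
def qapPolytope (n : ℕ) : Set (QAPSpace n) :=
  convexHull ℝ (Set.range (qapVertex (n := n)))

/-- The data of a QAP4 inequality: `m ≥ 7`, distinct `i_1, …, i_m` and distinct `j_1, …, j_m`
(so that `n ≥ 7` as well). -/
structure QAP4 (n : ℕ) where
  m : ℕ
  seven_le : 7 ≤ m
  i : Fin m ↪ Fin n
  j : Fin m ↪ Fin n

namespace QAP4

variable {n : ℕ}

/-- The left-hand side `∑_r Y_{i_r j_r, i_r j_r} - ∑_{r < s} Y_{i_r j_r, i_s j_s}`. -/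
def lhs (h : QAP4 n) (Y : QAPSpace n) : ℝ :=
  ∑ r, Y (h.i r, h.j r) (h.i r, h.j r) -
    ∑ r, ∑ s ∈ Finset.Ioi r, Y (h.i r, h.j r) (h.i s, h.j s)

/-- The inequality `lhs ≤ 1` holds on all of `R`. -/
def ValidOn (h : QAP4 n) (R : Set (QAPSpace n)) : Prop := ∀ Y ∈ R, h.lhs Y ≤ 1

/-- The slack of the inequality `lhs ≤ 1` at `Y`. -/
def slack (h : QAP4 n) (Y : QAPSpace n) : ℝ := 1 - h.lhs Y

/-- The number of `r` with `P_σ(i_r, j_r) = 1`. -/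
def hits (h : QAP4 n) (σ : Equiv.Perm (Fin n)) : ℕ :=
  (Finset.univ.filter fun r => σ (h.i r) = h.j r).card

end QAP4

/-- A bounded relaxation of the QAP-polytope (a polytope containing it) for which all
QAP4 inequalities are valid. -/
def IsQAP4Relaxation {n : ℕ} (R : Set (QAPSpace n)) : Prop :=
  IsPolytope R ∧ qapPolytope n ⊆ R ∧ ∀ h : QAP4 n, h.ValidOn R

/-- The matrix `N^k_n`, with entry `(aᵀb - k)(aᵀb - k - 1)` for `a, b ∈ {0,1}^n`. -/
def Nmat (k n : ℕ) : Matrix (Fin n → Fin 2) (Fin n → Fin 2) ℝ :=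
  Matrix.of fun a b =>
    ((∑ i, ((a i : ℕ) : ℝ) * ((b i : ℕ) : ℝ)) - k) *
      ((∑ i, ((a i : ℕ) : ℝ) * ((b i : ℕ) : ℝ)) - k - 1)

/-- The 0/1 vectors with at least seven ones. -/
abbrev RowVec (n : ℕ) : Type :=
  {a : Fin n → Fin 2 // 7 ≤ (Finset.univ.filter fun i => a i = 1).card}

/-- The 0/1 vectors whose number of zeros is not exactly one. -/
abbrev ColVec (n : ℕ) : Type :=
  {b : Fin n → Fin 2 // (Finset.univ.filter fun i => b i = 0).card ≠ 1}

end

/-!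
The matrix `P_σ^{[2]}` is rank one with 0/1 factors, so the slack of a QAP4 inequality at it
depends only on the number `q` of index pairs it hits, and equals `(q - 1)(q - 2) / 2`. For the
diagonal inequality with index pairs `(i, i)`, `i ∈ S`, the number `q` counts the fixed points of
`σ` in `S`. The moved points of a permutation can form any set which is not a singleton, so with
`S` and the fixed-point set as indices these slacks are the entries of `N¹ / 2`.

For the lower bound, let `Q` be an extension of `R`. An inequality valid on `R` and tight at some
point of `R` defines a face of `Q`. Whenever it is strict at a point, some facet of `Q` contains
this face and misses a lift of the point. Each facet therefore contributes a rectangle, and these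
rectangles cover the support of the slack matrix exactly. Fix an `m`-element set whose complement
in `Fin n` has seven elements; adding the complement to the row sets and removing it from the
fixed points realises all pairs of subsets of the `m`-element set. The slack of a pair is positive
if the two subsets are disjoint and zero if they meet in one element. Following Kaibel and Weltge,
a rectangle without pairs of the second kind contains at most `2 ^ m` of the `3 ^ m` disjoint
pairs, by induction on `m`, so `Q` has at least `(3 / 2) ^ m` facets.
-/

open scoped Finset

section Polyhedron

variable {ι E : Type*} [AddCommGroup E] [Module ℝ E]
  {A : ι → Module.Dual ℝ E} {b : ι → ℝ} {C Q : Set E}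

/-- The polyhedron cut out by the linear inequalities `A i x ≤ b i`. -/
def polyhedron (A : ι → Module.Dual ℝ E) (b : ι → ℝ) : Set E := {x | ∀ i, A i x ≤ b i}

/-- The inequalities of the system `A i x ≤ b i` that hold with equality at `x`. -/
def activeSet (A : ι → Module.Dual ℝ E) (b : ι → ℝ) (x : E) : Set ι := {i | A i x = b i}

lemma convex_polyhedron (A : ι → Module.Dual ℝ E) (b : ι → ℝ) : Convex ℝ (polyhedron A b) := by
  simp only [polyhedron, Set.ofPred_forall]
  exact convex_iInter fun i => convex_halfSpace_le (A i).isLinear (b i)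

lemma exists_pos_add_smul_mem_polyhedron [Finite ι] {x v : E} (hx : x ∈ polyhedron A b)
    (hv : ∀ i ∈ activeSet A b x, A i v ≤ 0) : ∃ ε : ℝ, 0 < ε ∧ x + ε • v ∈ polyhedron A b := by
  have eventually_le : ∀ᶠ ε in nhdsWithin (0 : ℝ) (Set.Ioi 0), ∀ i, A i (x + ε • v) ≤ b i := by
    refine Filter.eventually_all.2 fun i => ?_
    simp only [map_add, map_smul, smul_eq_mul]
    rcases (hx i).lt_or_eq with hlt | heq
    · have hcont : Continuous fun ε : ℝ => A i x + ε * A i v := by fun_prop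
      have htendsto := (hcont.tendsto 0).mono_left (nhdsWithin_le_nhds (s := Set.Ioi 0))
      exact (htendsto.eventually_lt_const (by simpa using hlt)).mono fun _ => le_of_lt
    · filter_upwards [self_mem_nhdsWithin] with ε hε
      linarith [mul_nonpos_of_nonneg_of_nonpos (le_of_lt hε) (hv i heq)]
  obtain ⟨ε, hmem, hε⟩ := (eventually_le.and self_mem_nhdsWithin).exists
  exact ⟨ε, hε, hmem⟩

lemma exists_minimal_activeSet [Finite ι] (hC : Convex ℝ C) (hne : C.Nonempty)
    (hsub : C ⊆ polyhedron A b) : ∃ x ∈ C, ∀ y ∈ C, activeSet A b x ⊆ activeSet A b y := by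
  obtain ⟨_, ⟨x, hx, rfl⟩, hmin⟩ :=
    exists_minimal_of_wellFoundedLT (· ∈ activeSet A b '' C) (hne.image _)
  refine ⟨x, hx, fun y hy => ?_⟩
  have active_midpoint : activeSet A b (midpoint ℝ x y) ⊆ activeSet A b x ∩ activeSet A b y := by
    intro i hi
    have hmid : (A i x + A i y) / 2 = b i := by
      rw [← show A i (midpoint ℝ x y) = b i from hi, midpoint_eq_smul_add]
      simp only [map_smul, map_add, invOf_eq_inv, smul_eq_mul]
      ring
    have hix := hsub hx i
    have hiy := hsub hy i
    constructor <;> simp only [activeSet, Set.mem_ofPred_eq] <;> linarith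
  have hle := hmin (Set.mem_image_of_mem _ (hC.midpoint_mem hx hy))
    (active_midpoint.trans Set.inter_subset_left)
  exact hle.trans (active_midpoint.trans Set.inter_subset_right)

lemma eq_of_mem_extremePoints_of_activeSet_eq [Finite ι] {x y : E}
    (hx : x ∈ (polyhedron A b).extremePoints ℝ) (hy : y ∈ polyhedron A b)
    (hxy : activeSet A b x = activeSet A b y) : x = y := by
  obtain ⟨ε, hε, hmem⟩ := exists_pos_add_smul_mem_polyhedron (v := x - y) hx.1 fun i hi => by
    have hiy : i ∈ activeSet A b y := hxy ▸ hi
    simp only [activeSet, Set.mem_ofPred_eq] at hi hiy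
    simp [hi, hiy]
  have hseg : x ∈ openSegment ℝ (x + ε • (x - y)) y := by
    refine ⟨1 / (1 + ε), ε / (1 + ε), by positivity, by positivity, by field_simp, ?_⟩
    match_scalars <;> field_simp
    ring
  exact ((mem_extremePoints.1 hx).2 _ hmem _ hy hseg).2.symm

lemma finite_extremePoints_polyhedron [Finite ι] (A : ι → Module.Dual ℝ E) (b : ι → ℝ) :
    ((polyhedron A b).extremePoints ℝ).Finite :=
  Set.Finite.of_injOn (Set.mapsTo_univ (activeSet A b) _)
    (fun _ hx _ hy hxy => eq_of_mem_extremePoints_of_activeSet_eq hx hy.1 hxy) Set.finite_univ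

lemma exists_pos_add_smul_mem_of_affineSpan_inter [Finite ι]
    (hQ : (affineSpan ℝ Q : Set E) ∩ polyhedron A b = Q) {x v : E} (hx : x ∈ Q)
    (hv : v ∈ vectorSpan ℝ Q) (hactive : ∀ i ∈ activeSet A b x, A i v ≤ 0) :
    ∃ ε : ℝ, 0 < ε ∧ x + ε • v ∈ Q := by
  obtain ⟨ε, hε, hmem⟩ :=
    exists_pos_add_smul_mem_polyhedron (Set.inter_subset_right (hQ.symm ▸ hx)) hactive
  refine ⟨ε, hε, hQ ▸ ⟨?_, hmem⟩⟩
  rw [add_comm]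
  refine AffineSubspace.vadd_mem_of_mem_direction ?_ (subset_affineSpan ℝ Q hx)
  rw [direction_affineSpan]
  exact Submodule.smul_mem _ _ hv

lemma exists_face_subset_notMem_activeSet [Finite ι]
    (hQ : (affineSpan ℝ Q : Set E) ∩ polyhedron A b = Q) {f : Module.Dual ℝ E} {β : ℝ}
    (hf : ∀ x ∈ Q, f x ≤ β) (hface : ∃ x ∈ Q, f x = β) {q : E} (hq : q ∈ Q) (hfq : f q < β) :
    ∃ i, (∀ x ∈ Q, f x = β → i ∈ activeSet A b x) ∧ i ∉ activeSet A b q := by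
  have hconv : Convex ℝ Q := hQ ▸ (affineSpan ℝ Q).convex.inter (convex_polyhedron A b)
  obtain ⟨y, ⟨hy, hfy⟩, hmin⟩ := exists_minimal_activeSet (A := A) (b := b)
    (hconv.inter (convex_hyperplane f.isLinear β)) hface
    fun x hx => Set.inter_subset_right (hQ.symm ▸ hx.1 : x ∈ _ ∩ polyhedron A b)
  by_contra! hcon
  -- No inequality blocks a small step from the generic point `y` of the face away from `q`,
  -- although `f` increases in this direction.
  obtain ⟨ε, hε, hmem⟩ := exists_pos_add_smul_mem_of_affineSpan_inter hQ hy
    (vsub_mem_vectorSpan ℝ hy hq) fun i hi => by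
      have hiq : A i q = b i := hcon i fun x hx hfx => hmin x ⟨hx, hfx⟩ hi
      simp [hiq, show A i y = b i from hi]
  have hle := hf _ hmem
  simp only [vsub_eq_sub, map_add, map_smul, map_sub, smul_eq_mul,
    show f y = β from hfy] at hle
  linarith [mul_pos hε (sub_pos.2 hfq)]

/-- The system `A i x ≤ b i` cuts `Q` out of its affine hull, and none of its inequalities can be
dropped. Irredundancy is relative to the affine hull because the facets of a polytope which is not
full-dimensional are determined only there. -/
structure IsIrredundant (Q : Set E) (A : ι → Module.Dual ℝ E) (b : ι → ℝ) : Prop where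
  affineSpan_inter : (affineSpan ℝ Q : Set E) ∩ polyhedron A b = Q
  exists_violation : ∀ i, ∃ y ∈ affineSpan ℝ Q, b i < A i y ∧ ∀ k ≠ i, A k y ≤ b k

lemma exists_isIrredundant_subsystem [Finite ι]
    (hQ : (affineSpan ℝ Q : Set E) ∩ polyhedron A b = Q) :
    ∃ J : Set ι, IsIrredundant Q (fun j : J => A j) (fun j : J => b j) := by
  obtain ⟨J, hJ, hmin⟩ := exists_minimal_of_wellFoundedLT (fun J : Set ι =>
    (affineSpan ℝ Q : Set E) ∩ polyhedron (fun j : J => A j) (fun j : J => b j) = Q)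
    ⟨Set.univ, by simpa [polyhedron] using hQ⟩
  refine ⟨J, hJ, fun ⟨j, hj⟩ => ?_⟩
  by_contra! hcon
  suffices hdrop : (affineSpan ℝ Q : Set E) ∩
      polyhedron (fun k : (J \ {j} : Set ι) => A k) (fun k => b k) = Q from
    (hmin hdrop Set.sdiff_subset hj).2 rfl
  refine Set.Subset.antisymm (fun x ⟨hx, hle⟩ => ?_) fun x hx => ?_
  · refine hJ ▸ ⟨hx, fun k => ?_⟩
    by_cases hkj : (k : ι) = j
    · by_contra! hlt
      obtain ⟨l, hlj, hlt'⟩ := hcon x hx (by simpa only [hkj] using hlt)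
      exact (hle ⟨l, l.2, fun h => hlj (Subtype.ext h)⟩).not_gt hlt'
    · exact hle ⟨k, k.2, hkj⟩
  · obtain ⟨hspan, hle⟩ := hJ.symm ▸ hx
    exact ⟨hspan, fun k => hle ⟨k, k.2.1⟩⟩

lemma vectorSpan_le_ker {k V W : Type*} [Ring k] [AddCommGroup V] [Module k V] [AddCommGroup W]
    [Module k W] {f : V →ₗ[k] W} {s : Set V} {c : W} (h : ∀ x ∈ s, f x = c) :
    vectorSpan k s ≤ LinearMap.ker f := by
  rw [vectorSpan_def, Submodule.span_le]
  rintro _ ⟨x, hx, y, hy, rfl⟩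
  simp [h x hx, h y hy]

namespace IsIrredundant

lemma subset_polyhedron (h : IsIrredundant Q A b) : Q ⊆ polyhedron A b :=
  fun _ hx => (h.affineSpan_inter.symm ▸ hx : _ ∈ _ ∩ polyhedron A b).2

lemma convex (h : IsIrredundant Q A b) : Convex ℝ Q :=
  h.affineSpan_inter ▸ (affineSpan ℝ Q).convex.inter (convex_polyhedron A b)

variable [Finite ι]

lemma exists_activeSet_eq_empty (h : IsIrredundant Q A b) (hne : Q.Nonempty) :
    ∃ z ∈ Q, activeSet A b z = ∅ := by
  obtain ⟨z, hz, hmin⟩ := exists_minimal_activeSet h.convex hne h.subset_polyhedron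
  refine ⟨z, hz, Set.eq_empty_of_forall_notMem fun i hi => ?_⟩
  obtain ⟨y, hy, hlt, -⟩ := h.exists_violation i
  have hyz := AffineSubspace.vsub_mem_direction hy (subset_affineSpan ℝ Q hz)
  rw [direction_affineSpan] at hyz
  have hker := vectorSpan_le_ker (fun x hx => hmin x hx hi) hyz
  simp only [vsub_eq_sub, LinearMap.mem_ker, map_sub, show A i z = b i from hi] at hker
  linarith

lemma exists_activeSet_eq_singleton (h : IsIrredundant Q A b) (hne : Q.Nonempty) (i : ι) :
    ∃ w ∈ Q, activeSet A b w = {i} := by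
  obtain ⟨z, hz, hactive⟩ := h.exists_activeSet_eq_empty hne
  have hzlt : ∀ k, A k z < b k := fun k => (h.subset_polyhedron hz k).lt_of_ne fun hk =>
    (hactive ▸ hk : k ∈ (∅ : Set ι))
  obtain ⟨y, hy, hylt, hyle⟩ := h.exists_violation i
  have hpos : 0 < A i y - A i z := by linarith [hzlt i]
  set t := (b i - A i z) / (A i y - A i z) with ht
  have ht0 : 0 < t := div_pos (by linarith [hzlt i]) hpos
  have ht1 : t < 1 := (div_lt_one hpos).2 (by linarith)
  set w := AffineMap.lineMap z y t with hw
  have hAw : ∀ k, A k w = A k z + t * (A k y - A k z) := fun k => by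
    simp [hw, AffineMap.lineMap_apply, add_comm]
  have hwi : A i w = b i := by
    rw [hAw, ht, div_mul_cancel₀ _ hpos.ne']
    ring
  have hwlt : ∀ k ≠ i, A k w < b k := fun k hk => by
    rw [hAw]
    nlinarith [hzlt k, hyle k hk]
  refine ⟨w, h.affineSpan_inter ▸ ⟨?_, fun k => ?_⟩, Set.ext fun k => ⟨fun hk => ?_, ?_⟩⟩
  · exact AffineMap.lineMap_mem t (subset_affineSpan ℝ Q hz) hy
  · rcases eq_or_ne k i with rfl | hk
    exacts [hwi.le, (hwlt k hk).le]
  · by_contra hki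
    exact (hwlt k hki).ne hk
  · rintro rfl
    exact hwi

lemma vectorSpan_face (h : IsIrredundant Q A b) (hne : Q.Nonempty) (i : ι) :
    vectorSpan ℝ {x ∈ Q | A i x = b i} = vectorSpan ℝ Q ⊓ LinearMap.ker (A i) := by
  refine le_antisymm (le_inf (vectorSpan_mono ℝ (Set.sep_subset _ _))
    (vectorSpan_le_ker fun x hx => hx.2)) fun v ⟨hvQ, hvi⟩ => ?_
  rw [SetLike.mem_coe, LinearMap.mem_ker] at hvi
  obtain ⟨w, hw, hactive⟩ := h.exists_activeSet_eq_singleton hne i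
  have hwi : A i w = b i := (hactive ▸ rfl : i ∈ activeSet A b w)
  obtain ⟨ε, hε, hmem⟩ := exists_pos_add_smul_mem_of_affineSpan_inter h.affineSpan_inter hw hvQ
    fun k hk => by
      obtain rfl : k = i := by rwa [hactive] at hk
      exact hvi.le
  have hspan := vsub_mem_vectorSpan ℝ
    (show w + ε • v ∈ {x ∈ Q | A i x = b i} from ⟨hmem, by simp [hvi, hwi]⟩)
    (show w ∈ {x ∈ Q | A i x = b i} from ⟨hw, hwi⟩)
  rw [vsub_eq_sub, add_sub_cancel_left] at hspan
  exact (Submodule.smul_mem_iff _ hε.ne').1 hspan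

end IsIrredundant

end Polyhedron

section Facets

lemma finrank_inf_ker_add_one {K V : Type*} [Field K] [AddCommGroup V] [Module K V]
    (W : Submodule K V) [FiniteDimensional K W] (f : Module.Dual K V) {v : V} (hv : v ∈ W)
    (hfv : f v ≠ 0) :
    Module.finrank K ↥(W ⊓ LinearMap.ker f) + 1 = Module.finrank K W := by
  have hne : f.comp W.subtype ≠ 0 := fun h => hfv (by simpa using LinearMap.congr_fun h ⟨v, hv⟩)
  rw [← Module.Dual.finrank_ker_add_one_of_ne_zero hne, LinearMap.ker_comp,
    ← Submodule.map_comap_subtype, Submodule.finrank_map_subtype_eq]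

lemma isExposed_face {E : Type*} [AddCommGroup E] [Module ℝ E] [TopologicalSpace E] {Q : Set E}
    (l : StrongDual ℝ E) {β : ℝ} (hle : ∀ x ∈ Q, l x ≤ β) : IsExposed ℝ Q {x ∈ Q | l x = β} := by
  rintro ⟨w, hw, hlw⟩
  refine ⟨l, Set.ext fun x => and_congr_right fun hx => ⟨fun hlx y hy => hlx ▸ hle y hy, ?_⟩⟩
  exact fun hmax => (hle x hx).antisymm (hlw ▸ hmax w hw)

variable {ι E : Type*} [Finite ι] [NormedAddCommGroup E] [NormedSpace ℝ E] [FiniteDimensional ℝ E]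

lemma IsIrredundant.isFacet {Q : Set E} {A : ι → Module.Dual ℝ E} {b : ι → ℝ}
    (h : IsIrredundant Q A b) (hne : Q.Nonempty) (i : ι) : IsFacet Q {x ∈ Q | A i x = b i} := by
  obtain ⟨z, hz, hzactive⟩ := h.exists_activeSet_eq_empty hne
  obtain ⟨w, hw, hwactive⟩ := h.exists_activeSet_eq_singleton hne i
  have hwi : A i w = b i := (hwactive ▸ rfl : i ∈ activeSet A b w)
  have hzi : A i z ≠ b i := fun hi => (hzactive ▸ hi : i ∈ (∅ : Set ι))
  refine ⟨isExposed_face (A i).toContinuousLinearMap fun x hx => h.subset_polyhedron hx i,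
    ⟨w, hw, hwi⟩, ?_⟩
  rw [affDim, affDim, h.vectorSpan_face hne i]
  refine finrank_inf_ker_add_one _ _ (vsub_mem_vectorSpan ℝ hw hz) ?_
  rwa [vsub_eq_sub, map_sub, hwi, sub_ne_zero, ne_comm]

lemma exists_isFacet_face_subset_notMem (A : ι → Module.Dual ℝ E) (b : ι → ℝ)
    {f : Module.Dual ℝ E} {β : ℝ} (hf : ∀ x ∈ polyhedron A b, f x ≤ β)
    (hface : ∃ x ∈ polyhedron A b, f x = β) {q : E} (hq : q ∈ polyhedron A b) (hfq : f q < β) :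
    ∃ F, IsFacet (polyhedron A b) F ∧ {x ∈ polyhedron A b | f x = β} ⊆ F ∧ q ∉ F := by
  obtain ⟨J, hJ⟩ := exists_isIrredundant_subsystem
    (Set.inter_eq_right.2 (subset_affineSpan ℝ (polyhedron A b)))
  obtain ⟨j, hsub, hqj⟩ := exists_face_subset_notMem_activeSet hJ.affineSpan_inter hf hface hq hfq
  exact ⟨_, hJ.isFacet ⟨q, hq⟩ j, fun x ⟨hx, hfx⟩ => ⟨hx, hsub x hx hfx⟩, fun hmem => hqj hmem.2⟩

end Facets

section Descriptions

variable {ι κ E : Type*} [NormedAddCommGroup E] [NormedSpace ℝ E] {P : Set E}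

lemma IsPolytope.isCompact [FiniteDimensional ℝ E] (hP : IsPolytope P) : IsCompact P := by
  obtain ⟨hbounded, p, A, b, rfl⟩ := hP
  have hproper : ProperSpace E := FiniteDimensional.proper_real E
  refine Metric.isCompact_of_isClosed_isBounded ?_ hbounded
  simp only [Set.ofPred_forall]
  exact isClosed_iInter fun i => isClosed_le (A i).continuous_of_finiteDimensional continuous_const

lemma IsPolytope.convex (hP : IsPolytope P) : Convex ℝ P := by
  obtain ⟨-, p, A, b, rfl⟩ := hP
  exact convex_polyhedron A b

lemma IsPolytope.finite_extremePoints (hP : IsPolytope P) : (P.extremePoints ℝ).Finite := by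
  obtain ⟨-, p, A, b, rfl⟩ := hP
  exact finite_extremePoints_polyhedron A b

lemma IsPolytope.convexHull_extremePoints [FiniteDimensional ℝ E] (hP : IsPolytope P) :
    convexHull ℝ (P.extremePoints ℝ) = P := by
  have krein_milman := closure_convexHull_extremePoints hP.isCompact hP.convex
  rwa [(hP.finite_extremePoints.isClosed_convexHull ℝ).closure_eq] at krein_milman

lemma IsPolytope.nonempty_polytopeDescription [FiniteDimensional ℝ E] (hP : IsPolytope P) :
    Nonempty (PolytopeDescription P) := by
  obtain ⟨q, v, -, hv⟩ := hP.finite_extremePoints.fin_param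
  obtain ⟨-, p, A, b, hA⟩ := id hP
  exact ⟨⟨p, q, A, b, v, hA, (hv ▸ hP.convexHull_extremePoints).symm⟩⟩

/-- A description enlarged by further valid inequalities and further points. -/
def PolytopeDescription.append (D : PolytopeDescription P) {p q : ℕ}
    (A : Fin p → Module.Dual ℝ E) (b : Fin p → ℝ) (v : Fin q → E)
    (hA : P ⊆ polyhedron A b) (hv : ∀ k, v k ∈ P) : PolytopeDescription P where
  p := D.p + p
  q := D.q + q
  A := Fin.append D.A A
  b := Fin.append D.b b
  v := Fin.append D.v v
  eq_inequalities := by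
    simp only [Fin.forall_fin_add, Fin.append_left, Fin.append_right, Set.ofPred_and,
      ← D.eq_inequalities]
    exact (Set.inter_eq_left.2 hA).symm
  eq_convexHull := by
    have hsub : Set.range D.v ⊆ P := (subset_convexHull ℝ _).trans D.eq_convexHull.ge
    refine Set.Subset.antisymm (D.eq_convexHull.le.trans (convexHull_mono ?_))
      (convexHull_min ?_ (D.eq_convexHull ▸ convex_convexHull ℝ _))
    · exact Set.range_subset_iff.2 fun i => ⟨Fin.castAdd q i, Fin.append_left _ _ _⟩
    · simp only [Set.range_subset_iff, Fin.forall_fin_add, Fin.append_left, Fin.append_right]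
      exact ⟨Set.range_subset_iff.1 hsub, hv⟩

lemma IsPolytope.exists_polytopeDescription [FiniteDimensional ℝ E] [Finite ι] [Finite κ]
    (hP : IsPolytope P) (A : ι → Module.Dual ℝ E) (b : ι → ℝ) (v : κ → E)
    (hA : P ⊆ polyhedron A b) (hv : ∀ k, v k ∈ P) :
    ∃ (D : PolytopeDescription P) (row : ι ↪ Fin D.p) (col : κ ↪ Fin D.q),
      (∀ i, D.A (row i) = A i) ∧ (∀ i, D.b (row i) = b i) ∧ ∀ k, D.v (col k) = v k := by
  obtain ⟨D⟩ := hP.nonempty_polytopeDescription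
  obtain ⟨p, ⟨e⟩⟩ := Finite.exists_equiv_fin ι
  obtain ⟨q, ⟨e'⟩⟩ := Finite.exists_equiv_fin κ
  refine ⟨D.append (A ∘ e.symm) (b ∘ e.symm) (v ∘ e'.symm) (fun x hx i => hA hx _) fun k => hv _,
    e.toEmbedding.trans (Fin.natAddEmb D.p), e'.toEmbedding.trans (Fin.natAddEmb D.q),
    fun i => ?_, fun i => ?_, fun k => ?_⟩
  · exact (Fin.append_right D.A _ (e i)).trans (congrArg A (e.symm_apply_apply i))
  · exact (Fin.append_right D.b _ (e i)).trans (congrArg b (e.symm_apply_apply i))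
  · exact (Fin.append_right D.v _ (e' k)).trans (congrArg v (e'.symm_apply_apply k))

end Descriptions

section RectangleCovers

variable {α β : Type*}

/-- The relation `r` is the union of the combinatorial rectangles `T.1 × T.2`, `T ∈ 𝓡`. -/
def IsRectangleCover (r : α → β → Prop) (𝓡 : Set (Set α × Set β)) : Prop :=
  ∀ a b, r a b ↔ ∃ T ∈ 𝓡, a ∈ T.1 ∧ b ∈ T.2

/-- The least number of combinatorial rectangles with union `r`. -/
noncomputable def rectangleCoverNumber (r : α → β → Prop) : ℕ∞ :=
  ⨅ (𝓡 : Set (Set α × Set β)) (_ : IsRectangleCover r 𝓡), 𝓡.encard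

variable {E : Type*} [NormedAddCommGroup E] [NormedSpace ℝ E] [FiniteDimensional ℝ E]
  {R : Set E} {f : α → Module.Dual ℝ E} {c : α → ℝ} {v : β → E}

lemma IsExtension.isRectangleCover_facets {r : ℕ} {Q : Set (E × (Fin r → ℝ))}
    (hQ : IsExtension Q R) (hf : ∀ a, ∀ x ∈ R, f a x ≤ c a) (htight : ∀ a, ∃ x ∈ R, f a x = c a)
    (hv : ∀ b, v b ∈ R) :
    IsRectangleCover (fun a b => f a (v b) < c a)
      ((fun F => ({a | ∀ x ∈ Q, f a x.1 = c a → x ∈ F}, {b | ∃ y, (v b, y) ∈ Q ∧ (v b, y) ∉ F})) ''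
        {F | IsFacet Q F}) := by
  obtain ⟨⟨-, p, A, b, rfl⟩, rfl⟩ := hQ
  refine fun i k => ⟨fun hlt => ?_, ?_⟩
  · obtain ⟨x, ⟨z, hz⟩, hx⟩ := htight i
    obtain ⟨y, hy⟩ := hv k
    obtain ⟨F, hF, hsub, hyF⟩ := exists_isFacet_face_subset_notMem A b
      (f := f i ∘ₗ LinearMap.fst ℝ E _) (fun x hx => hf i _ ⟨x.2, hx⟩) ⟨(x, z), hz, hx⟩ hy hlt
    exact ⟨_, ⟨F, hF, rfl⟩, fun x hx hfx => hsub ⟨hx, hfx⟩, y, hy, hyF⟩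
  · rintro ⟨_, ⟨F, -, rfl⟩, hi, y, hy, hyF⟩
    exact (hf i _ (hv k)).lt_of_ne fun heq => hyF (hi _ hy heq)

lemma rectangleCoverNumber_le_extensionComplexity (hf : ∀ a, ∀ x ∈ R, f a x ≤ c a)
    (htight : ∀ a, ∃ x ∈ R, f a x = c a) (hv : ∀ b, v b ∈ R) :
    rectangleCoverNumber (fun a b => f a (v b) < c a) ≤ extensionComplexity R :=
  le_iInf fun _ => le_iInf fun _ => le_iInf fun hQ =>
    (iInf₂_le _ (hQ.isRectangleCover_facets hf htight hv)).trans (Set.encard_image_le _ _)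

end RectangleCovers

section UniqueDisjointness

variable {γ : Type*} [DecidableEq γ]

/-- The pairs of disjoint sets, one from each family. -/
def disjointPairs (𝒜 ℬ : Finset (Finset γ)) : Finset (Finset γ × Finset γ) :=
  {p ∈ 𝒜 ×ˢ ℬ | Disjoint p.1 p.2}

lemma mk_mem_disjointPairs {𝒜 ℬ : Finset (Finset γ)} {A B : Finset γ} :
    (A, B) ∈ disjointPairs 𝒜 ℬ ↔ (A ∈ 𝒜 ∧ B ∈ ℬ) ∧ Disjoint A B := by
  rw [disjointPairs, Finset.mem_filter, Finset.mem_product]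

lemma card_disjointPairs_powerset (U : Finset γ) :
    #(disjointPairs U.powerset U.powerset) = 3 ^ #U := by
  have hfiber : ∀ A ∈ U.powerset, #{B ∈ U.powerset | Disjoint A B} = 2 ^ (#U - #A) := by
    intro A hA
    rw [← Finset.card_sdiff_of_subset (Finset.mem_powerset.1 hA), ← Finset.card_powerset]
    congr 1
    ext B
    rw [Finset.mem_filter, Finset.mem_powerset, Finset.mem_powerset, Finset.subset_sdiff,
      disjoint_comm]
  calc #(disjointPairs U.powerset U.powerset)
      = ∑ A ∈ U.powerset, #{B ∈ U.powerset | Disjoint A B} := by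
        simp only [disjointPairs, Finset.card_filter, Finset.sum_product]
    _ = ∑ A ∈ U.powerset, 1 ^ #A * 2 ^ (#U - #A) := by
        simpa only [one_pow, one_mul] using Finset.sum_congr rfl hfiber
    _ = 3 ^ #U := Finset.sum_pow_mul_eq_add_pow 1 2 U

lemma disjointPairs_union_left (𝒜 𝒜' ℬ : Finset (Finset γ)) :
    disjointPairs (𝒜 ∪ 𝒜') ℬ = disjointPairs 𝒜 ℬ ∪ disjointPairs 𝒜' ℬ := by
  rw [disjointPairs, Finset.union_product, Finset.filter_union, ← disjointPairs, ← disjointPairs]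

lemma disjointPairs_union_right (𝒜 ℬ ℬ' : Finset (Finset γ)) :
    disjointPairs 𝒜 (ℬ ∪ ℬ') = disjointPairs 𝒜 ℬ ∪ disjointPairs 𝒜 ℬ' := by
  rw [disjointPairs, Finset.product_union, Finset.filter_union, ← disjointPairs, ← disjointPairs]

lemma card_disjointPairs_le_add (x : γ) (𝒜 ℬ : Finset (Finset γ)) :
    #(disjointPairs 𝒜 ℬ) ≤ #(disjointPairs (𝒜.nonMemberSubfamily x) (ℬ.nonMemberSubfamily x)) +
      #(disjointPairs (𝒜.memberSubfamily x) (ℬ.nonMemberSubfamily x)) +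
      #(disjointPairs (𝒜.nonMemberSubfamily x) (ℬ.memberSubfamily x)) := by
  set D₀₀ := disjointPairs (𝒜.nonMemberSubfamily x) (ℬ.nonMemberSubfamily x)
  set D₁₀ := disjointPairs (𝒜.memberSubfamily x) (ℬ.nonMemberSubfamily x)
  set D₀₁ := disjointPairs (𝒜.nonMemberSubfamily x) (ℬ.memberSubfamily x)
  have hsub : disjointPairs 𝒜 ℬ ⊆
      D₀₀ ∪ D₁₀.image (Prod.map (insert x) id) ∪ D₀₁.image (Prod.map id (insert x)) := by
    rintro ⟨A, B⟩ hAB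
    obtain ⟨⟨hA, hB⟩, hdisj⟩ := mk_mem_disjointPairs.1 hAB
    simp only [D₀₀, D₁₀, D₀₁, Finset.mem_union, Finset.mem_image, Prod.exists,
      mk_mem_disjointPairs, Finset.mem_memberSubfamily, Finset.mem_nonMemberSubfamily]
    by_cases hxA : x ∈ A
    · refine .inl (.inr ⟨A.erase x, B, ⟨⟨⟨by rwa [Finset.insert_erase hxA], by simp⟩, hB,
        Finset.disjoint_left.1 hdisj hxA⟩, hdisj.mono_left (Finset.erase_subset _ _)⟩, ?_⟩)
      simp [Finset.insert_erase hxA]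
    by_cases hxB : x ∈ B
    · refine .inr ⟨A, B.erase x, ⟨⟨⟨hA, hxA⟩, by rwa [Finset.insert_erase hxB], by simp⟩,
        hdisj.mono_right (Finset.erase_subset _ _)⟩, ?_⟩
      simp [Finset.insert_erase hxB]
    · exact .inl (.inl ⟨⟨⟨hA, hxA⟩, hB, hxB⟩, hdisj⟩)
  calc #(disjointPairs 𝒜 ℬ)
      ≤ #(D₀₀ ∪ D₁₀.image (Prod.map (insert x) id) ∪ D₀₁.image (Prod.map id (insert x))) :=
        Finset.card_le_card hsub
    _ ≤ #D₀₀ + #(D₁₀.image (Prod.map (insert x) id)) + #(D₀₁.image (Prod.map id (insert x))) :=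
        (Finset.card_union_le _ _).trans (Nat.add_le_add_right (Finset.card_union_le _ _) _)
    _ ≤ #D₀₀ + #D₁₀ + #D₀₁ :=
        Nat.add_le_add (Nat.add_le_add_left Finset.card_image_le _) Finset.card_image_le

lemma card_add_card_add_card_le_of_disjoint {δ : Type*} [DecidableEq δ] {s t u : Finset δ}
    (htu : Disjoint t u) : #s + #t + #u ≤ #(s ∪ t) + #(s ∪ u) := by
  have hle : #(s ∩ t) + #u ≤ #(s ∪ u) := by
    have hdisj : Disjoint (s ∩ t) u := htu.mono_left Finset.inter_subset_right
    rw [← Finset.card_union_of_disjoint hdisj]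
    exact Finset.card_le_card (Finset.union_subset_union_left Finset.inter_subset_left)
  linarith [Finset.card_union_add_card_inter s t]

lemma disjoint_disjointPairs_memberSubfamily (x : γ) {𝒜 ℬ : Finset (Finset γ)}
    (h : ∀ A ∈ 𝒜, ∀ B ∈ ℬ, #(A ∩ B) ≠ 1) :
    Disjoint (disjointPairs (𝒜.memberSubfamily x) (ℬ.nonMemberSubfamily x))
      (disjointPairs (𝒜.nonMemberSubfamily x) (ℬ.memberSubfamily x)) := by
  refine Finset.disjoint_left.2 fun ⟨A, B⟩ h₁ h₂ => ?_
  obtain ⟨⟨hA, -⟩, hdisj⟩ := mk_mem_disjointPairs.1 h₁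
  obtain ⟨⟨-, hB⟩, -⟩ := mk_mem_disjointPairs.1 h₂
  refine h _ (Finset.mem_memberSubfamily.1 hA).1 _ (Finset.mem_memberSubfamily.1 hB).1 ?_
  rw [← Finset.insert_inter_distrib, Finset.disjoint_iff_inter_eq_empty.1 hdisj, insert_empty_eq,
    Finset.card_singleton]

lemma card_disjointPairs_le_two_pow {U : Finset γ} {𝒜 ℬ : Finset (Finset γ)}
    (h𝒜 : ∀ A ∈ 𝒜, A ⊆ U) (hℬ : ∀ B ∈ ℬ, B ⊆ U) (h : ∀ A ∈ 𝒜, ∀ B ∈ ℬ, #(A ∩ B) ≠ 1) :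
    #(disjointPairs 𝒜 ℬ) ≤ 2 ^ #U := by
  induction U using Finset.induction_on generalizing 𝒜 ℬ with
  | empty => grind [Finset.card_le_one, disjointPairs]
  | insert x U hx ih =>
    set 𝒜₀ := 𝒜.nonMemberSubfamily x
    set 𝒜₁ := 𝒜.memberSubfamily x
    set ℬ₀ := ℬ.nonMemberSubfamily x
    set ℬ₁ := ℬ.memberSubfamily x
    -- In both cases one family avoids `x`, so dropping `x` from the other changes no intersection.
    have hleft : #(disjointPairs (𝒜₀ ∪ 𝒜₁) ℬ₀) ≤ 2 ^ #U := by
      apply ih <;> grind [Finset.mem_memberSubfamily, Finset.mem_nonMemberSubfamily]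
    have hright : #(disjointPairs 𝒜₀ (ℬ₀ ∪ ℬ₁)) ≤ 2 ^ #U := by
      apply ih <;> grind [Finset.mem_memberSubfamily, Finset.mem_nonMemberSubfamily]
    calc #(disjointPairs 𝒜 ℬ)
        ≤ #(disjointPairs 𝒜₀ ℬ₀) + #(disjointPairs 𝒜₁ ℬ₀) + #(disjointPairs 𝒜₀ ℬ₁) :=
          card_disjointPairs_le_add x 𝒜 ℬ
      _ ≤ #(disjointPairs (𝒜₀ ∪ 𝒜₁) ℬ₀) + #(disjointPairs 𝒜₀ (ℬ₀ ∪ ℬ₁)) := by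
        rw [disjointPairs_union_left, disjointPairs_union_right]
        exact card_add_card_add_card_le_of_disjoint (disjoint_disjointPairs_memberSubfamily x h)
      _ ≤ 2 ^ #(insert x U) := by
        rw [Finset.card_insert_of_notMem hx, pow_succ, mul_two]
        exact add_le_add hleft hright

lemma three_pow_card_le_encard_mul_two_pow [Fintype γ] {r : Finset γ → Finset γ → Prop}
    {𝓡 : Set (Set (Finset γ) × Set (Finset γ))} (h𝓡 : IsRectangleCover r 𝓡)
    (hdisj : ∀ A B, Disjoint A B → r A B) (hone : ∀ A B, #(A ∩ B) = 1 → ¬ r A B) :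
    (3 : ℕ∞) ^ Fintype.card γ ≤ 𝓡.encard * 2 ^ Fintype.card γ := by
  classical
  rcases 𝓡.finite_or_infinite with hfin | hinf
  swap
  · simp [hinf.encard_eq, ENat.top_mul]
  let D (T : Set (Finset γ) × Set (Finset γ)) := disjointPairs {A | A ∈ T.1} {B | B ∈ T.2}
  have hcover : disjointPairs Finset.univ.powerset Finset.univ.powerset ⊆
      hfin.toFinset.biUnion D := by
    rintro ⟨A, B⟩ hAB
    have hd := (mk_mem_disjointPairs.1 hAB).2
    obtain ⟨T, hT, hA, hB⟩ := (h𝓡 A B).1 (hdisj A B hd)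
    simp only [D, Finset.mem_biUnion, Set.Finite.mem_toFinset, mk_mem_disjointPairs,
      Finset.mem_filter_univ]
    exact ⟨T, hT, ⟨hA, hB⟩, hd⟩
  have hD : ∀ T ∈ hfin.toFinset, #(D T) ≤ 2 ^ Fintype.card γ := fun T hT =>
    card_disjointPairs_le_two_pow (fun A _ => Finset.subset_univ A)
      (fun B _ => Finset.subset_univ B) fun A hA B hB hAB =>
        hone A B hAB ((h𝓡 A B).2 ⟨T, hfin.mem_toFinset.1 hT, Finset.mem_filter_univ _ |>.1 hA,
          Finset.mem_filter_univ _ |>.1 hB⟩)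
  rw [hfin.encard_eq_coe_toFinset_card]
  exact_mod_cast calc 3 ^ Fintype.card γ
      = #(disjointPairs (Finset.univ : Finset γ).powerset Finset.univ.powerset) :=
        (card_disjointPairs_powerset _).symm
    _ ≤ #(hfin.toFinset.biUnion D) := Finset.card_le_card hcover
    _ ≤ #hfin.toFinset * 2 ^ Fintype.card γ := Finset.card_biUnion_le_card_mul _ _ _ hD

lemma three_pow_card_le_rectangleCoverNumber_mul_two_pow [Fintype γ]
    {r : Finset γ → Finset γ → Prop} (hdisj : ∀ A B, Disjoint A B → r A B)
    (hone : ∀ A B, #(A ∩ B) = 1 → ¬ r A B) :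
    (3 : ℕ∞) ^ Fintype.card γ ≤ rectangleCoverNumber r * 2 ^ Fintype.card γ := by
  simp only [rectangleCoverNumber, ENat.iInf_mul_of_ne (pow_ne_zero _ two_ne_zero)]
  exact le_iInf₂ fun 𝓡 h𝓡 => three_pow_card_le_encard_mul_two_pow h𝓡 hdisj hone

end UniqueDisjointness

section Slack

lemma two_mul_choose_two {R : Type*} [CommRing R] [BinomialRing R] (z : R) :
    2 * Ring.choose z 2 = z * (z - 1) := by
  have h := Ring.descPochhammer_eq_factorial_smul_choose z 2
  simp only [descPochhammer_succ_right, descPochhammer_zero, one_mul, Nat.cast_zero, sub_zero,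
    Nat.cast_one, Polynomial.smeval_mul, Polynomial.smeval_sub, Polynomial.smeval_X,
    Polynomial.smeval_one, pow_one, pow_zero, one_smul, Nat.factorial_two, nsmul_eq_mul] at h
  exact_mod_cast h.symm

lemma two_mul_sum_sum_Ioi_mul {ι R : Type*} [Fintype ι] [LinearOrder ι] [LocallyFiniteOrderTop ι]
    [LocallyFiniteOrderBot ι] [CommRing R] (x : ι → R) :
    2 * ∑ r, ∑ s ∈ Finset.Ioi r, x r * x s = (∑ r, x r) ^ 2 - ∑ r, x r * x r := by
  have off_diag := Finset.sum_sum_Ioi_add_eq_sum_sum_off_diag fun r s => x r * x s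
  have split_diag : ∀ r, ∑ s, x s * x r = ∑ s ∈ {r}ᶜ, x s * x r + x r * x r := fun r => by
    rw [add_comm, Fintype.sum_eq_add_sum_compl r]
  calc 2 * ∑ r, ∑ s ∈ Finset.Ioi r, x r * x s
      = ∑ r, ∑ s ∈ Finset.Ioi r, (x s * x r + x r * x s) := by
        simp only [Finset.mul_sum, two_mul, mul_comm (x _) (x _)]
    _ = ∑ r, ∑ s ∈ {r}ᶜ, x s * x r := off_diag
    _ = (∑ r, x r) ^ 2 - ∑ r, x r * x r := by
        rw [eq_sub_iff_add_eq, ← Finset.sum_add_distrib, sq, Finset.sum_mul_sum, Finset.sum_comm]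
        exact Finset.sum_congr rfl fun r _ => (split_diag r).symm

lemma exists_perm_support_eq {α : Type*} [Fintype α] [DecidableEq α] {S : Finset α}
    (hS : #S ≠ 1) : ∃ σ : Equiv.Perm α, σ.support = S := by
  obtain ⟨σ, hcycle, hsub⟩ := Finset.exists_cycleOn S
  refine ⟨σ, hsub.antisymm fun x hx => Equiv.Perm.mem_support.2 ?_⟩
  have hnontrivial : S.Nontrivial :=
    Finset.one_lt_card_iff_nontrivial.1 (by have := Finset.card_pos.2 ⟨x, hx⟩; omega)
  exact hcycle.apply_ne hnontrivial hx

namespace QAP4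

variable {n : ℕ}

lemma slack_qapVertex (h : QAP4 n) (σ : Equiv.Perm (Fin n)) :
    h.slack (qapVertex σ) = ((h.hits σ : ℝ) - 1) * ((h.hits σ : ℝ) - 2) / 2 := by
  set x : Fin h.m → ℝ := fun r => if σ (h.i r) = h.j r then 1 else 0 with hx
  have entry_eq : ∀ r s, qapVertex σ (h.i r, h.j r) (h.i s, h.j s) = x r * x s := fun r s => by
    simp [qapVertex, hx, PEquiv.toMatrix_apply, Equiv.toPEquiv_apply]
  have sum_eq : ∑ r, x r = h.hits σ := by simp [hx, hits]
  have x_idem : ∀ r, x r * x r = x r := fun r => by simp [hx]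
  have sum_pairs := two_mul_sum_sum_Ioi_mul x
  simp only [x_idem, sum_eq] at sum_pairs
  simp only [slack, lhs, entry_eq, x_idem, sum_eq]
  linarith

lemma slack_qapVertex_eq_choose (h : QAP4 n) (σ : Equiv.Perm (Fin n)) :
    h.slack (qapVertex σ) = ((Ring.choose ((h.hits σ : ℤ) - 1) 2 : ℤ) : ℝ) := by
  have two_mul_choose : (2 : ℝ) * ((Ring.choose ((h.hits σ : ℤ) - 1) 2 : ℤ) : ℝ) =
      ((h.hits σ : ℝ) - 1) * ((h.hits σ : ℝ) - 1 - 1) := by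
    exact_mod_cast two_mul_choose_two ((h.hits σ : ℤ) - 1)
  rw [slack_qapVertex]
  linarith

lemma lhs_qapVertex_eq_one {h : QAP4 n} {σ : Equiv.Perm (Fin n)} (hq : h.hits σ = 1) :
    h.lhs (qapVertex σ) = 1 := by
  have hslack := h.slack_qapVertex σ
  rw [slack, hq] at hslack
  norm_num at hslack
  linarith

lemma lhs_qapVertex_lt_one {h : QAP4 n} {σ : Equiv.Perm (Fin n)} (hq : h.hits σ = 0) :
    h.lhs (qapVertex σ) < 1 := by
  have hslack := h.slack_qapVertex σ
  rw [slack, hq] at hslack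
  norm_num at hslack
  linarith

/-- The left-hand side of a QAP4 inequality as a linear functional. -/
def lhsLinear (h : QAP4 n) : Module.Dual ℝ (QAPSpace n) where
  toFun := h.lhs
  map_add' X Y := by
    simp only [lhs, Pi.add_apply, Finset.sum_add_distrib]
    ring
  map_smul' c X := by
    simp only [lhs, Pi.smul_apply, smul_eq_mul, ← Finset.mul_sum, RingHom.id_apply]
    ring

lemma lhsLinear_apply (h : QAP4 n) (Y : QAPSpace n) : h.lhsLinear Y = h.lhs Y := rfl

/-- The QAP4 inequality with the index pairs `(i, i)`, `i ∈ S`. -/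
def diag (S : Finset (Fin n)) (hS : 7 ≤ #S) : QAP4 n where
  m := #S
  seven_le := hS
  i := (S.orderEmbOfFin rfl).toEmbedding
  j := (S.orderEmbOfFin rfl).toEmbedding

lemma hits_diag (S : Finset (Fin n)) (hS : 7 ≤ #S) (σ : Equiv.Perm (Fin n)) :
    (diag S hS).hits σ = #(S \ σ.support) := by
  have map_eq : Finset.univ.map (diag S hS).i = S := S.map_orderEmbOfFin_univ rfl
  calc (diag S hS).hits σ = #({r | σ ((diag S hS).i r) = (diag S hS).i r} : Finset _) := rfl
    _ = #{x ∈ S | σ x = x} := by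
      conv_rhs => rw [← map_eq, Finset.filter_map, Finset.card_map]
      rfl
    _ = #(S \ σ.support) := by
      congr 1
      ext x
      simp only [Finset.mem_filter, Finset.mem_sdiff, Equiv.Perm.notMem_support]

lemma exists_perm_hits_diag_eq_one (S : Finset (Fin n)) (hS : 7 ≤ #S) :
    ∃ σ : Equiv.Perm (Fin n), (diag S hS).hits σ = 1 := by
  obtain ⟨t, ht⟩ := Finset.card_pos.1 (by omega : 0 < #S)
  have hn : 7 ≤ n := hS.trans (card_finset_fin_le S)
  obtain ⟨σ, hσ⟩ := exists_perm_support_eq (S := ({t}ᶜ : Finset (Fin n)))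
    (by rw [Finset.card_compl, Fintype.card_fin, Finset.card_singleton]; omega)
  refine ⟨σ, ?_⟩
  rw [hits_diag, hσ, sdiff_compl, Finset.inf_eq_inter, Finset.inter_singleton_of_mem ht,
    Finset.card_singleton]

end QAP4
end Slack

section LowerBound

lemma qapVertex_mem_qapPolytope {n : ℕ} (σ : Equiv.Perm (Fin n)) : qapVertex σ ∈ qapPolytope n :=
  subset_convexHull ℝ _ (Set.mem_range_self σ)

lemma card_map_union_compl_sdiff {γ δ : Type*} [Fintype γ] [DecidableEq γ] [Fintype δ]
    [DecidableEq δ] (e : γ ↪ δ) (A B : Finset γ) :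
    #((A.map e ∪ (Finset.univ.map e)ᶜ) \ (B.map e)ᶜ) = #(A ∩ B) := by
  rw [← Finset.card_map e, Finset.map_inter]
  congr 1
  have hB : B.map e ⊆ Finset.univ.map e := Finset.map_subset_map.2 (Finset.subset_univ B)
  rw [sdiff_compl, Finset.inf_eq_inter, Finset.union_inter_distrib_right,
    Finset.disjoint_iff_inter_eq_empty.1 (disjoint_compl_left.mono_right hB), Finset.union_empty]

lemma three_pow_le_extensionComplexity_mul_two_pow {m n : ℕ} (hmn : m + 7 ≤ n)
    {R : Set (QAPSpace n)} (hsub : qapPolytope n ⊆ R) (hvalid : ∀ h : QAP4 n, h.ValidOn R) :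
    (3 : ℕ∞) ^ m ≤ extensionComplexity R * 2 ^ m := by
  let e : Fin m ↪ Fin n := Fin.castLEEmb (by omega)
  let row (A : Finset (Fin m)) : Finset (Fin n) := A.map e ∪ (Finset.univ.map e)ᶜ
  have seven_le_row : ∀ A, 7 ≤ #(row A) := fun A => by
    refine le_trans ?_ (Finset.card_le_card Finset.subset_union_right)
    rw [Finset.card_compl, Finset.card_map, Finset.card_univ, Fintype.card_fin, Fintype.card_fin]
    omega
  have exists_col : ∀ B : Finset (Fin m), ∃ σ : Equiv.Perm (Fin n), σ.support = (B.map e)ᶜ := by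
    refine fun B => exists_perm_support_eq ?_
    have hB := card_finset_fin_le B
    rw [Finset.card_compl, Finset.card_map, Fintype.card_fin]
    omega
  choose col hcol using exists_col
  have hits_eq : ∀ A B, (QAP4.diag (row A) (seven_le_row A)).hits (col B) = #(A ∩ B) :=
    fun A B => by rw [QAP4.hits_diag, hcol, card_map_union_compl_sdiff]
  have qapVertex_mem : ∀ σ, qapVertex σ ∈ R := fun σ => hsub (qapVertex_mem_qapPolytope σ)
  have cover_le := rectangleCoverNumber_le_extensionComplexity (R := R) (c := fun _ => 1)
    (f := fun A => (QAP4.diag (row A) (seven_le_row A)).lhsLinear)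
    (v := fun B => qapVertex (col B)) (fun A => hvalid _)
    (fun A => (QAP4.exists_perm_hits_diag_eq_one (row A) (seven_le_row A)).imp' qapVertex
      fun σ hσ => ⟨qapVertex_mem σ, QAP4.lhs_qapVertex_eq_one hσ⟩)
    fun B => qapVertex_mem (col B)
  have le_cover := three_pow_card_le_rectangleCoverNumber_mul_two_pow
    (r := fun A B => (QAP4.diag (row A) (seven_le_row A)).lhsLinear (qapVertex (col B)) < 1)
    (fun A B hAB => QAP4.lhs_qapVertex_lt_one (by
      rw [hits_eq, Finset.disjoint_iff_inter_eq_empty.1 hAB, Finset.card_empty]))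
    fun A B hAB => (QAP4.lhs_qapVertex_eq_one ((hits_eq A B).trans hAB)).not_lt
  rw [Fintype.card_fin] at le_cover
  exact le_cover.trans (mul_le_mul_left cover_le _)

lemma two_rpow_half_mul_two_pow_le (m : ℕ) :
    (2 : ℝ≥0∞) ^ ((m : ℝ) / 2) * 2 ^ m ≤ 3 ^ m := by
  refine (ENNReal.pow_le_pow_left_iff two_ne_zero).1 ?_
  calc ((2 : ℝ≥0∞) ^ ((m : ℝ) / 2) * 2 ^ m) ^ 2 = 8 ^ m := by
        rw [mul_pow, ← ENNReal.rpow_mul_natCast, Nat.cast_two, div_mul_cancel₀ _ two_ne_zero,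
          ENNReal.rpow_natCast, pow_right_comm, ← mul_pow]
        norm_num
    _ ≤ 9 ^ m := pow_le_pow_left' (by norm_num) m
    _ = (3 ^ m) ^ 2 := by
        rw [pow_right_comm]
        norm_num

lemma two_rpow_quarter_le_extensionComplexity {n : ℕ} (hn : 14 ≤ n) {R : Set (QAPSpace n)}
    (hsub : qapPolytope n ⊆ R) (hvalid : ∀ h : QAP4 n, h.ValidOn R) :
    (2 : ℝ≥0∞) ^ (1 / 4 * (n : ℝ)) ≤ extensionComplexity R := by
  obtain ⟨m, rfl⟩ := Nat.exists_eq_add_of_le' (show 7 ≤ n by omega)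
  have three_pow_le : (3 : ℝ≥0∞) ^ m ≤ extensionComplexity R * 2 ^ m := by
    exact_mod_cast ENat.toENNReal_le.2
      (three_pow_le_extensionComplexity_mul_two_pow le_rfl hsub hvalid)
  have hm : (7 : ℝ) ≤ m := by exact_mod_cast (by omega : 7 ≤ m)
  calc (2 : ℝ≥0∞) ^ (1 / 4 * ((m + 7 : ℕ) : ℝ))
      ≤ 2 ^ ((m : ℝ) / 2) := ENNReal.rpow_le_rpow_of_exponent_le one_le_two (by push_cast; linarith)
    _ ≤ extensionComplexity R := (ENNReal.mul_le_mul_iff_left (by simp) (by simp)).1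
        ((two_rpow_half_mul_two_pow_le m).trans three_pow_le)

end LowerBound

section SlackMatrix

lemma sum_mul_eq_card_sdiff {ι R : Type*} [Fintype ι] [DecidableEq ι] [NonAssocSemiring R]
    (a b : ι → Fin 2) :
    ∑ i, ((a i : ℕ) : R) * ((b i : ℕ) : R) =
      #(({i | a i = 1} : Finset ι) \ ({i | b i = 0} : Finset ι)) := by
  have mul_eq_ite : ∀ x y : Fin 2,
      ((x : ℕ) : R) * ((y : ℕ) : R) = if x = 1 ∧ ¬ y = 0 then 1 else 0 := fun x y => by
    fin_cases x <;> fin_cases y <;> simp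
  rw [← Finset.filter_and_not, ← Finset.sum_boole]
  exact Finset.sum_congr rfl fun i _ => mul_eq_ite (a i) (b i)

lemma QAP4.slack_diag_qapVertex {n : ℕ} (a : RowVec n) {b : Fin n → Fin 2}
    {σ : Equiv.Perm (Fin n)} (hσ : σ.support = ({i | b i = 0} : Finset (Fin n))) :
    (QAP4.diag _ a.2).slack (qapVertex σ) = (1 / 2 : ℝ) * Nmat 1 n a b := by
  rw [QAP4.slack_qapVertex, QAP4.hits_diag, hσ, Nmat, Matrix.of_apply, sum_mul_eq_card_sdiff]
  push_cast
  ring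

end SlackMatrix

theorem mainTheorem5 :
    (∃ c : ℝ, 0 < c ∧ ∃ n₀ : ℕ, ∀ n : ℕ, n₀ ≤ n → ∀ R : Set (QAPSpace n),
      IsQAP4Relaxation R →
        (2 : ℝ≥0∞) ^ (c * (n : ℝ)) ≤ (extensionComplexity R : ℝ≥0∞)) ∧
    (∀ (n : ℕ) (h : QAP4 n) (σ : Equiv.Perm (Fin n)),
      h.slack (qapVertex σ) = ((Ring.choose ((h.hits σ : ℤ) - 1) 2 : ℤ) : ℝ)) ∧
    (∀ (n : ℕ) (R : Set (QAPSpace n)), IsQAP4Relaxation R →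
      ∃ (D : PolytopeDescription R) (row : RowVec n ↪ Fin D.p) (col : ColVec n ↪ Fin D.q),
        (∀ a, ∃ h : QAP4 n, D.b (row a) = 1 ∧ ∀ Y, D.A (row a) Y = h.lhs Y) ∧
        (∀ b, ∃ σ : Equiv.Perm (Fin n), D.v (col b) = qapVertex σ) ∧
        D.slackMatrix.submatrix row col =
          (1 / 2 : ℝ) • (Nmat 1 n).submatrix Subtype.val Subtype.val) := by
  refine ⟨⟨1 / 4, by norm_num, 14, fun n hn R ⟨_, hsub, hvalid⟩ => ?_⟩, fun n h σ => ?_,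
    fun n R ⟨hpoly, hsub, hvalid⟩ => ?_⟩
  · exact two_rpow_quarter_le_extensionComplexity hn hsub hvalid
  · exact h.slack_qapVertex_eq_choose σ
  · choose σ hσ using fun b : ColVec n => exists_perm_support_eq b.2
    obtain ⟨D, row, col, hA, hb, hv⟩ := hpoly.exists_polytopeDescription
      (fun a : RowVec n => (QAP4.diag _ a.2).lhsLinear) (fun _ => 1) (fun b => qapVertex (σ b))
      (fun Y hY a => hvalid _ Y hY) fun b => hsub (qapVertex_mem_qapPolytope (σ b))
    refine ⟨D, row, col, fun a => ⟨QAP4.diag _ a.2, hb a, fun Y => ?_⟩, fun b => ⟨σ b, hv b⟩, ?_⟩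
    · rw [hA, QAP4.lhsLinear_apply]
    · ext a b
      calc D.slackMatrix (row a) (col b) = (QAP4.diag _ a.2).slack (qapVertex (σ b)) := by
            rw [PolytopeDescription.slackMatrix, Matrix.of_apply, hA, hb, hv, QAP4.lhsLinear_apply,
              QAP4.slack]
        _ = (1 / 2 : ℝ) * Nmat 1 n a b := QAP4.slack_diag_qapVertex a (hσ b)
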